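/- Let $\Gamma$ be a (discrete) group and let $\Lambda\le\Gamma$ be a subgroup that is commensurated (for every $g\in\Gamma$ the subgroups $g\Lambda g^{-1}$ and $\Lambda$ are commensurable) and locally finite (every finitely generated subgroup of $\Lambda$ is finite). Let $\operatorname{Sym}(\Gamma/\Lambda)$ carry the topology of pointwise convergence, $\Gamma/\Lambda$ being discrete, let $\alpha\colon\Gamma\to\operatorname{Sym}(\Gamma/\Lambda)$ be the homomorphism given by left multiplication, and let $G=\Gamma/\!/\Lambda=\overline{\alpha(\Gamma)}$ be the Schlichting completion of $\Gamma$ relative to $\Lambda$. Let $H^*_c(G,\mathbb R)$ be the cohomology of the complex $C(G^{*+1},\mathbb R)^G$ of continuous $G$-invariant homogeneous cochains, and let $H^*(\Gamma,\mathbb R)$ be the cohomology of the complex $\hom(\mathbb R[\Gamma^{*+1}],\mathbb R)^\Gamma$ of all $\Gamma$-invariant homogeneous cochains. Then the restriction map $$H^n_c(G,\mathbb R)\to H^n(\Gamma,\mathbb R),$$ induced by $f\mapsto f\circ\alpha^{n+1}$ on cochains, is an isomorphism of real vector spaces for every $n\ge 0$. -/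

import Mathlib

open CategoryTheory

universe u

/-! ### The Schlichting completion -/

section Schlichting

/-- The topology of pointwise convergence on `Sym(X)`: the topology induced by the inclusion of
`Sym(X)` in the product `X → X`, each factor `X` being discrete. -/
instance permPointwiseTopology (X : Type*) : TopologicalSpace (Equiv.Perm X) :=
  TopologicalSpace.induced (fun σ : Equiv.Perm X => (σ : X → X))
    (@Pi.topologicalSpace X (fun _ => X) (fun _ => ⊥))

theorem isOpen_perm_apply_eq {X : Type*} (x y : X) :
    IsOpen {σ : Equiv.Perm X | σ x = y} := by
  let _ : TopologicalSpace X := ⊥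
  have : DiscreteTopology X := ⟨rfl⟩
  exact isOpen_induced (f := fun σ : Equiv.Perm X => (σ : X → X))
    ((isOpen_discrete ({y} : Set X)).preimage (continuous_apply x))

theorem continuous_perm_of_forall {X Y : Type*} [TopologicalSpace Y] {f : Y → Equiv.Perm X}
    (h : ∀ x y, IsOpen {t : Y | f t x = y}) : Continuous f := by
  let _ : TopologicalSpace X := ⊥
  have : DiscreteTopology X := ⟨rfl⟩
  refine continuous_induced_rng.2 (continuous_pi fun x => ?_)
  exact continuous_discrete_rng.2 fun y => h x y

instance permIsTopologicalGroup (X : Type*) : IsTopologicalGroup (Equiv.Perm X) where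
  continuous_mul := by
    refine continuous_perm_of_forall fun x y => ?_
    have : {t : Equiv.Perm X × Equiv.Perm X | (t.1 * t.2) x = y} =
        ⋃ z : X, {σ | σ z = y} ×ˢ {τ | τ x = z} := by
      ext ⟨σ, τ⟩
      simp
    rw [this]
    exact isOpen_iUnion fun z => (isOpen_perm_apply_eq z y).prod (isOpen_perm_apply_eq x z)
  continuous_inv := by
    refine continuous_perm_of_forall fun x y => ?_
    have : {σ : Equiv.Perm X | σ⁻¹ x = y} = {σ | σ y = x} := by
      ext σ
      exact Equiv.Perm.inv_eq_iff_eq.trans eq_comm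
    rw [this]
    exact isOpen_perm_apply_eq y x

variable {Γ : Type u} [Group Γ]

/-- A subgroup `Λ` of `Γ` is commensurated if `gΛg⁻¹` and `Λ` are commensurable for every
`g` in `Γ`. -/
def Subgroup.IsCommensurated (Λ : Subgroup Γ) : Prop :=
  ∀ g : Γ, g ∈ Subgroup.Commensurable.commensurator Λ

/-- A subgroup is locally finite if all its finitely generated subgroups are finite. -/
def Subgroup.IsLocallyFinite (Λ : Subgroup Γ) : Prop :=
  ∀ H : Subgroup Γ, H ≤ Λ → H.FG → Finite H

/-- The homomorphism `Γ → Sym(Γ/Λ)` given by left multiplication. -/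
def cosetAction (Λ : Subgroup Γ) : Γ →* Equiv.Perm (Γ ⧸ Λ) :=
  MulAction.toPermHom Γ (Γ ⧸ Λ)

/-- The Schlichting completion `Γ//Λ`: the closure of the image of `Γ` in `Sym(Γ/Λ)`, with the
subspace topology. -/
def schlichtingCompletion (Λ : Subgroup Γ) : Subgroup (Equiv.Perm (Γ ⧸ Λ)) :=
  (cosetAction Λ).range.topologicalClosure

/-- The canonical homomorphism `α : Γ → Γ//Λ`. -/
def toSchlichtingCompletion (Λ : Subgroup Γ) : Γ →* schlichtingCompletion Λ :=
  (cosetAction Λ).codRestrict (schlichtingCompletion Λ) fun γ =>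
    Subgroup.le_topologicalClosure _ ⟨γ, rfl⟩

end Schlichting

/-! ### Continuous and discrete group cohomology with real coefficients -/

section Cohomology

/-- The coboundary `(δf)(x₀,…,xₙ₊₁) = ∑ᵢ (-1)ⁱ f(x₀,…,x̂ᵢ,…,xₙ₊₁)` on real functions. -/
def coboundary (X : Type u) (n : ℕ) :
    ((Fin (n + 1) → X) → ℝ) →ₗ[ℝ] ((Fin (n + 2) → X) → ℝ) where
  toFun f x := ∑ i : Fin (n + 2), (-1 : ℝ) ^ (i : ℕ) * f (fun j => x (i.succAbove j))
  map_add' f g := by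
    funext x
    simp [mul_add, Finset.sum_add_distrib]
  map_smul' r f := by
    funext x
    simp [Finset.mul_sum, mul_left_comm]

theorem coboundary_coboundary (X : Type u) (n : ℕ) (f : (Fin (n + 1) → X) → ℝ) :
    coboundary X (n + 1) (coboundary X n f) = 0 := by
  funext x
  simp only [coboundary, LinearMap.coe_mk, AddHom.coe_mk, Finset.mul_sum, ← Finset.sum_product',
    Finset.univ_product_univ, Pi.zero_apply]
  refine Finset.sum_involution (fun p _ => (p.1.succAbove p.2, p.2.predAbove p.1)) ?_ ?_ ?_ ?_
  · rintro ⟨i, j⟩ -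
    have hs : (-1 : ℝ) ^ ((i.succAbove j : Fin (n + 3)) : ℕ) *
        (-1) ^ ((j.predAbove i : Fin (n + 2)) : ℕ) = -((-1) ^ (i : ℕ) * (-1) ^ (j : ℕ)) := by
      rcases lt_or_ge j.castSucc i with h | h
      · obtain ⟨m, rfl⟩ : ∃ m, i = Fin.succ m := ⟨i.pred (Fin.ne_zero_of_lt h), by simp⟩
        rw [Fin.succAbove_of_castSucc_lt _ _ h, Fin.predAbove_of_castSucc_lt _ _ h]
        simp only [Fin.val_castSucc, Fin.pred_succ, Fin.val_succ]
        ring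
      · rw [Fin.succAbove_of_le_castSucc _ _ h, Fin.predAbove_of_le_castSucc _ _ h]
        simp only [Fin.val_succ, Fin.coe_castPred]
        ring
    simp only [Fin.succAbove_succAbove_succAbove_predAbove, ← mul_assoc, hs]
    ring
  · rintro ⟨i, j⟩ - - h
    exact Fin.succAbove_ne i j (congrArg Prod.fst h)
  · intro _ _
    exact Finset.mem_univ _
  · rintro ⟨i, j⟩ -
    exact Prod.ext (Fin.succAbove_succAbove_predAbove i j)
      (Fin.predAbove_predAbove_succAbove i j)

/-- The `G`-invariant functions on `Gⁿ⁺¹`, for the diagonal left translation action: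
these are the elements of `Hom(ℝ[Gⁿ⁺¹], ℝ)^G`. -/
def invariantCochains (G : Type u) [Group G] (n : ℕ) : Submodule ℝ ((Fin (n + 1) → G) → ℝ) where
  carrier := {f | ∀ (g : G) (x : Fin (n + 1) → G), f (fun i => g * x i) = f x}
  add_mem' hf hf' g x := by simp [hf g x, hf' g x]
  zero_mem' _ _ := rfl
  smul_mem' r f hf g x := by simp [hf g x]

/-- The continuous `G`-invariant functions on `Gⁿ⁺¹`, that is `C(Gⁿ⁺¹, ℝ)^G`. -/
def continuousInvariantCochains (G : Type u) [Group G] [TopologicalSpace G] (n : ℕ) :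
    Submodule ℝ ((Fin (n + 1) → G) → ℝ) where
  carrier := {f | Continuous f ∧ f ∈ invariantCochains G n}
  add_mem' hf hf' := ⟨hf.1.add hf'.1, add_mem hf.2 hf'.2⟩
  zero_mem' := ⟨continuous_const, zero_mem _⟩
  smul_mem' r _ hf := ⟨hf.1.const_smul r, Submodule.smul_mem _ r hf.2⟩

theorem coboundary_mem_invariantCochains (G : Type u) [Group G] (n : ℕ)
    (f : (Fin (n + 1) → G) → ℝ) (hf : f ∈ invariantCochains G n) :
    coboundary G n f ∈ invariantCochains G (n + 1) := by
  intro g x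
  change ∑ i : Fin (n + 2), (-1 : ℝ) ^ (i : ℕ) * f (fun j => g * x (i.succAbove j)) =
    ∑ i : Fin (n + 2), (-1 : ℝ) ^ (i : ℕ) * f (fun j => x (i.succAbove j))
  exact Finset.sum_congr rfl fun i _ => by rw [hf g fun j => x (i.succAbove j)]

theorem coboundary_mem_continuousInvariantCochains (G : Type u) [Group G] [TopologicalSpace G]
    (n : ℕ) (f : (Fin (n + 1) → G) → ℝ) (hf : f ∈ continuousInvariantCochains G n) :
    coboundary G n f ∈ continuousInvariantCochains G (n + 1) := by
  refine ⟨?_, coboundary_mem_invariantCochains G n f hf.2⟩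
  change Continuous fun x : Fin (n + 2) → G =>
    ∑ i : Fin (n + 2), (-1 : ℝ) ^ (i : ℕ) * f (fun j => x (i.succAbove j))
  refine continuous_finsetSum _ fun i _ => continuous_const.mul (hf.1.comp ?_)
  exact continuous_pi fun j => continuous_apply _

/-- The complex `Hom(ℝ[G^{*+1}], ℝ)^G` of homogeneous cochains of the abstract group `G`. -/
noncomputable def groupCochainComplex (G : Type u) [Group G] :
    CochainComplex (ModuleCat.{u} ℝ) ℕ :=
  CochainComplex.of (fun n => ModuleCat.of ℝ (invariantCochains G n))
    (fun n => ModuleCat.ofHom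
      ((coboundary G n).restrict (coboundary_mem_invariantCochains G n)))
    fun n => by
      refine ModuleCat.hom_ext (LinearMap.ext fun f => ?_)
      exact Subtype.ext (coboundary_coboundary G n f.1)

/-- The complex `C(G^{*+1}, ℝ)^G` of continuous homogeneous cochains of a topological group. -/
noncomputable def continuousCochainComplex (G : Type u) [Group G] [TopologicalSpace G] :
    CochainComplex (ModuleCat.{u} ℝ) ℕ :=
  CochainComplex.of (fun n => ModuleCat.of ℝ (continuousInvariantCochains G n))
    (fun n => ModuleCat.ofHom
      ((coboundary G n).restrict (coboundary_mem_continuousInvariantCochains G n)))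
    fun n => by
      refine ModuleCat.hom_ext (LinearMap.ext fun f => ?_)
      exact Subtype.ext (coboundary_coboundary G n f.1)

/-- The cohomology `Hⁿ(G, ℝ)` of the abstract group `G` with trivial real coefficients. -/
noncomputable def realGroupCohomology (G : Type u) [Group G] (n : ℕ) : ModuleCat.{u} ℝ :=
  (groupCochainComplex G).homology n

/-- The continuous cohomology `Hⁿ_c(G, ℝ)` with trivial real coefficients. -/
noncomputable def realContinuousCohomology (G : Type u) [Group G] [TopologicalSpace G] (n : ℕ) :
    ModuleCat.{u} ℝ :=
  (continuousCochainComplex G).homology n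

/-- Pulling back continuous cochains along a homomorphism `φ : Γ → G` of an abstract group to a
topological group, `f ↦ f ∘ φⁿ⁺¹`, in degree `n`. -/
def cochainRestriction {Γ G : Type u} [Group Γ] [Group G] [TopologicalSpace G] (φ : Γ →* G)
    (n : ℕ) : continuousInvariantCochains G n →ₗ[ℝ] invariantCochains Γ n where
  toFun f := ⟨fun x => f.1 (fun i => φ (x i)), fun g x => by
    simpa using f.2.2 (φ g) fun i => φ (x i)⟩
  map_add' _ _ := rfl
  map_smul' _ _ := rfl

/-- The cochain map `C(G^{*+1}, ℝ)^G → Hom(ℝ[Γ^{*+1}], ℝ)^Γ` induced by `φ : Γ → G`. -/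
noncomputable def cochainComplexRestriction {Γ G : Type u} [Group Γ] [Group G]
    [TopologicalSpace G] (φ : Γ →* G) : continuousCochainComplex G ⟶ groupCochainComplex Γ where
  f n := ModuleCat.ofHom (cochainRestriction φ n)
  comm' i j hij := by
    obtain rfl : i + 1 = j := hij
    simp only [groupCochainComplex, continuousCochainComplex, CochainComplex.of_d]
    rfl

/-- The restriction map `Hⁿ_c(G, ℝ) → Hⁿ(Γ, ℝ)` along `φ : Γ → G`. -/
noncomputable def cohomologyRestriction {Γ G : Type u} [Group Γ] [Group G]
    [TopologicalSpace G] (φ : Γ →* G) (n : ℕ) :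
    realContinuousCohomology G n ⟶ realGroupCohomology Γ n :=
  HomologicalComplex.homologyMap (cochainComplexRestriction φ) n

end Cohomology

/-! ### Slices and the augmented coboundary -/

section Slice

variable {X : Type u}

/-! A locally finite group carries a left-invariant, normalized linear functional `M` on all real
functions, unbounded ones included, which is bounded by the sup norm on bounded functions
(`exists_invariant_mean`). Averaging every variable of a cochain over its right `Λ`-translates by
means of `M` gives an equivariant cochain map. It is homotopic to the identity (`average_sub_eq`)
because it is a natural map respecting the augmentation.

An averaged cochain on `Γ` is right `Λ`-invariant in each variable (`average_mul_right`). It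
therefore depends only on cosets and extends to a locally constant cochain on the completion `G`;
this defines a cochain map `S` in the direction opposite to restriction `R`. Restricting after
extending is averaging on `Γ`. Extending after restricting is averaging on `G` over the image of
`Λ`, since both are continuous and agree on the dense image of `Γ`. Hence `R` and `S` are inverse up
to homotopy.

On `G` the average and its homotopy must preserve continuity. Commensuration makes the `Λ`-orbits on
`Γ/Λ` finite, so `Λ` maps into a compact set (`exists_isCompact_schlichtingCompletion`), on whose
continuous functions `M` is 1-Lipschitz (`continuous_functional`). -/

/-- Fixing the first variable of a function of `n + 1` variables. -/
def slice {n : ℕ} (a : X) : ((Fin (n + 1) → X) → ℝ) →ₗ[ℝ] ((Fin n → X) → ℝ) :=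
  LinearMap.funLeft ℝ ℝ (fun y => Fin.cons a y)

theorem slice_apply {n : ℕ} (a : X) (f : (Fin (n + 1) → X) → ℝ) (y : Fin n → X) :
    slice a f y = f (Fin.cons a y) := rfl

/-- The coboundary from functions of `n` variables to functions of `n + 1` variables, including
the augmentation for `n = 0`. -/
def augCoboundary (X : Type u) : (n : ℕ) → ((Fin n → X) → ℝ) →ₗ[ℝ] ((Fin (n + 1) → X) → ℝ)
  | 0 => LinearMap.funLeft ℝ ℝ Fin.tail
  | n + 1 => coboundary X n

theorem slice_augCoboundary_zero (a : X) (f : (Fin 0 → X) → ℝ) :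
    slice a (augCoboundary X 0 f) = f := by
  funext y
  simp [slice_apply, augCoboundary, LinearMap.funLeft_apply]

/-- The cone identity: omitting the first variable returns `f`, and omitting any other commutes with
slicing up to sign. Together with `eq_of_slice_eq` it replaces signed sums by inductions on the
number of variables. -/
theorem slice_augCoboundary_succ {n : ℕ} (a : X) (f : (Fin (n + 1) → X) → ℝ) :
    slice a (augCoboundary X (n + 1) f) = f - augCoboundary X n (slice a f) := by
  funext y
  cases n with
  | zero =>
    simp [slice_apply, augCoboundary, coboundary, LinearMap.funLeft_apply, Fin.sum_univ_two]
    rw [← sub_eq_add_neg]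
    congr 2
    all_goals
      funext j
      fin_cases j
      simp
  | succ n =>
    simp only [slice_apply, augCoboundary, coboundary, LinearMap.coe_mk, AddHom.coe_mk,
      Pi.sub_apply]
    rw [Fin.sum_univ_succ]
    simp only [Fin.val_zero, pow_zero, one_mul, Fin.zero_succAbove, Fin.cons_succ, Fin.val_succ,
      pow_succ]
    rw [sub_eq_add_neg, ← Finset.sum_neg_distrib]
    congr 1
    refine Finset.sum_congr rfl fun i _ => ?_
    have : (fun j => (Fin.cons a y : Fin (n + 3) → X) (i.succ.succAbove j)) =
        Fin.cons a (fun j => y (i.succAbove j)) := by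
      funext j
      refine Fin.cases ?_ (fun j => ?_) j <;> simp
    rw [this]
    ring

theorem eq_of_slice_eq {n : ℕ} {f g : (Fin (n + 1) → X) → ℝ}
    (h : ∀ a, slice a f = slice a g) : f = g := by
  funext x
  have := congrFun (h (x 0)) (Fin.tail x)
  simpa [slice_apply, Fin.cons_self_tail] using this

theorem augCoboundary_augCoboundary (n : ℕ) (f : (Fin n → X) → ℝ) :
    augCoboundary X (n + 1) (augCoboundary X n f) = 0 := by
  refine eq_of_slice_eq fun a => ?_
  rw [slice_augCoboundary_succ]
  cases n with
  | zero => rw [slice_augCoboundary_zero]; simp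
  | succ n =>
    rw [slice_augCoboundary_succ, map_sub,
      show augCoboundary X (n + 1) (augCoboundary X n (slice a f)) = 0 from ?_]
    · simp
    · exact augCoboundary_augCoboundary n _

/-- At a fixed point the coboundary is a finite linear combination of evaluations, so linearity of
`M` suffices. -/
theorem augCoboundary_functional {K : Type*} (M : (K → ℝ) →ₗ[ℝ] ℝ) (n : ℕ) (F : K → (Fin n → X) → ℝ) (x : Fin (n + 1) → X) :
    augCoboundary X n (fun y => M fun k => F k y) x = M fun k => augCoboundary X n (F k) x := by
  cases n with
  | zero => rfl
  | succ n =>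
    simp only [augCoboundary, coboundary, LinearMap.coe_mk, AddHom.coe_mk]
    have : (fun k => ∑ i : Fin (n + 2), (-1 : ℝ) ^ (i : ℕ) * F k fun j => x (i.succAbove j)) =
        ∑ i : Fin (n + 2), (-1 : ℝ) ^ (i : ℕ) • fun k => F k fun j => x (i.succAbove j) := by
      funext k
      simp [Finset.sum_apply]
    rw [this, map_sum]
    simp

end Slice

/-! ### Averaging operators -/

section Average

variable {K : Type*} {G : Type u} [Group G] (β : K → G) (M : (K → ℝ) →ₗ[ℝ] ℝ)

/-- The operator averaging each variable of a function on `Gⁿ` over its right translates by `β`,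
with respect to the linear functional `M`. -/
noncomputable def average : (n : ℕ) → ((Fin n → G) → ℝ) →ₗ[ℝ] ((Fin n → G) → ℝ)
  | 0 => LinearMap.id
  | n + 1 => LinearMap.pi fun x => M ∘ₗ LinearMap.pi fun k =>
      LinearMap.proj (Fin.tail x) ∘ₗ average n ∘ₗ slice (x 0 * β k)

theorem average_succ_apply (n : ℕ) (f : (Fin (n + 1) → G) → ℝ) (x : Fin (n + 1) → G) :
    average β M (n + 1) f x = M fun k => average β M n (slice (x 0 * β k) f) (Fin.tail x) := rfl

theorem slice_average_succ (n : ℕ) (f : (Fin (n + 1) → G) → ℝ) (a : G) (y : Fin n → G) :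
    slice a (average β M (n + 1) f) y = M fun k => average β M n (slice (a * β k) f) y := by
  rw [slice_apply, average_succ_apply, Fin.cons_zero, Fin.tail_cons]

theorem map_const_of_map_one (hM : M (fun _ => 1) = 1) (c : ℝ) : M (fun _ => c) = c := by
  have : (fun _ : K => c) = c • (fun _ : K => (1 : ℝ)) := by funext; simp
  rw [this, map_smul, hM]; simp

/-- Slicing reduces the claim to fewer variables; the term `f` of the cone identity does not involve
the averaged variable, which is where `M 1 = 1` enters. The iterated means are never interchanged,
so no Fubini property is needed. -/
theorem average_augCoboundary (hM : M (fun _ => 1) = 1) (n : ℕ) (f : (Fin n → G) → ℝ) :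
    average β M (n + 1) (augCoboundary G n f) = augCoboundary G n (average β M n f) := by
  induction n with
  | zero =>
    funext x
    simp only [average_succ_apply, slice_augCoboundary_zero]
    exact map_const_of_map_one M hM _
  | succ n ih =>
    refine eq_of_slice_eq fun a => ?_
    funext y
    rw [slice_augCoboundary_succ, slice_average_succ]
    simp only [slice_augCoboundary_succ, map_sub, ih, Pi.sub_apply]
    have : (fun k => average β M (n + 1) f y -
        augCoboundary G n (average β M n (slice (a * β k) f)) y) =
        (fun _ => average β M (n + 1) f y) -
        fun k => augCoboundary G n (average β M n (slice (a * β k) f)) y := rfl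
    rw [this, map_sub, map_const_of_map_one M hM, ← augCoboundary_functional]
    rfl

/-- The homotopy between the averaging operator and the identity. -/
noncomputable def averageHomotopy : (n : ℕ) → ((Fin (n + 1) → G) → ℝ) →ₗ[ℝ] ((Fin n → G) → ℝ)
  | 0 => 0
  | n + 1 => LinearMap.pi fun x => LinearMap.proj x ∘ₗ
      (average β M (n + 1) - LinearMap.id - augCoboundary G n ∘ₗ averageHomotopy n) ∘ₗ slice (x 0)

theorem averageHomotopy_succ_apply (n : ℕ) (f : (Fin (n + 2) → G) → ℝ) (x : Fin (n + 1) → G) :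
    averageHomotopy β M (n + 1) f x = average β M (n + 1) (slice (x 0) f) x - slice (x 0) f x -
      augCoboundary G n (averageHomotopy β M n (slice (x 0) f)) x := rfl

/-- The homotopy solves this equation recursively, by coning with the first variable `x 0` as apex.
A moving apex, unlike a fixed base point, keeps the homotopy equivariant. -/
theorem average_sub_eq (hM : M (fun _ => 1) = 1) (n : ℕ) (f : (Fin (n + 1) → G) → ℝ) :
    average β M (n + 1) f - f = augCoboundary G n (averageHomotopy β M n f) +
      averageHomotopy β M (n + 1) (augCoboundary G (n + 1) f) := by
  induction n with
  | zero =>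
    funext x
    have h (g : (Fin 1 → G) → ℝ) : averageHomotopy β M 0 g = 0 := rfl
    rw [Pi.add_apply, averageHomotopy_succ_apply, slice_augCoboundary_succ]
    simp only [map_sub, h, average_augCoboundary β M hM, Pi.sub_apply, map_zero, Pi.zero_apply]
    simp [average]
  | succ n ih =>
    -- The induction hypothesis for `g`, after applying the coboundary; it makes the terms
    -- containing the slice cancel.
    have key (g : (Fin (n + 1) → G) → ℝ) :
        augCoboundary G (n + 1) (averageHomotopy β M (n + 1) (augCoboundary G (n + 1) g)) =
          average β M (n + 2) (augCoboundary G (n + 1) g) - augCoboundary G (n + 1) g := by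
      rw [average_augCoboundary β M hM, ← map_sub, ih, map_add, augCoboundary_augCoboundary,
        zero_add]
    funext x
    rw [Pi.add_apply, averageHomotopy_succ_apply, slice_augCoboundary_succ]
    simp only [map_sub, key, Pi.sub_apply]
    ring

/-! ### Equivariance -/

/-- Left translation of a function on `Gⁿ` by the diagonal action. -/
def translateCochain {n : ℕ} (g : G) (f : (Fin n → G) → ℝ) : (Fin n → G) → ℝ :=
  fun x => f fun i => g * x i

theorem slice_translate {n : ℕ} (g a : G) (f : (Fin (n + 1) → G) → ℝ) :
    slice a (translateCochain g f) = translateCochain g (slice (g * a) f) := by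
  funext y
  simp only [slice_apply, translateCochain]
  congr 1
  funext j
  refine Fin.cases ?_ (fun j => ?_) j <;> simp

theorem average_translate (n : ℕ) (g : G) (f : (Fin n → G) → ℝ) :
    average β M n (translateCochain g f) = translateCochain g (average β M n f) := by
  induction n with
  | zero => rfl
  | succ n ih =>
    funext x
    simp only [average_succ_apply, slice_translate, ih, translateCochain, mul_assoc]
    rfl

theorem augCoboundary_translate (n : ℕ) (g : G) (f : (Fin n → G) → ℝ) :
    augCoboundary G n (translateCochain g f) = translateCochain g (augCoboundary G n f) := by
  cases n <;> rfl

theorem averageHomotopy_translate (n : ℕ) (g : G) (f : (Fin (n + 1) → G) → ℝ) :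
    averageHomotopy β M n (translateCochain g f) = translateCochain g (averageHomotopy β M n f) := by
  induction n with
  | zero => rfl
  | succ n ih =>
    funext x
    simp only [averageHomotopy_succ_apply, slice_translate, ih, average_translate,
      augCoboundary_translate]
    rfl

theorem mem_invariantCochains_iff {n : ℕ} (f : (Fin (n + 1) → G) → ℝ) :
    f ∈ invariantCochains G n ↔ ∀ g, translateCochain g f = f :=
  ⟨fun h g => funext (h g), fun h g x => congrFun (h g) x⟩

theorem average_mem_invariantCochains {n : ℕ} {f : (Fin (n + 1) → G) → ℝ}
    (hf : f ∈ invariantCochains G n) : average β M (n + 1) f ∈ invariantCochains G n := by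
  rw [mem_invariantCochains_iff] at hf ⊢
  intro g
  rw [← average_translate, hf]

theorem averageHomotopy_mem_invariantCochains {n : ℕ} {f : (Fin (n + 2) → G) → ℝ}
    (hf : f ∈ invariantCochains G (n + 1)) :
    averageHomotopy β M (n + 1) f ∈ invariantCochains G n := by
  rw [mem_invariantCochains_iff] at hf ⊢
  intro g
  rw [← averageHomotopy_translate, hf]

/-! ### Invariance and functoriality -/

theorem average_comp {H : Type u} [Group H] (φ : G →* H) (n : ℕ) (f : (Fin n → H) → ℝ)
    (x : Fin n → G) :
    average β M n (fun y => f fun i => φ (y i)) x =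
      average (fun k => φ (β k)) M n f fun i => φ (x i) := by
  induction n with
  | zero => rfl
  | succ n ih =>
    simp only [average_succ_apply]
    congr 1
    funext k
    rw [← map_mul, show Fin.tail (fun i => φ (x i)) = fun i => φ (Fin.tail x i) from rfl, ← ih]
    refine congrFun (congrArg (average β M n) (funext fun y => congrArg f ?_)) _
    funext j
    refine Fin.cases ?_ (fun j => ?_) j <;> simp

/-- Replacing `x i` by `x i * β k` left-translates the function fed to `M`, so left invariance of
`M` gives right invariance of the average. -/
theorem average_mul_right {K : Type*} [Group K] (β : K →* G) (M : (K → ℝ) →ₗ[ℝ] ℝ)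
    (hM : ∀ k f, M (fun l => f (k * l)) = M f) (n : ℕ) (f : (Fin n → G) → ℝ) (x : Fin n → G)
    (k : Fin n → K) :
    average β M n f (fun i => x i * β (k i)) = average β M n f x := by
  induction n with
  | zero => exact congrArg f (Subsingleton.elim _ _)
  | succ n ih =>
    simp only [average_succ_apply]
    refine Eq.trans (congrArg M (funext fun l => ?_)) (hM (k 0) _)
    rw [map_mul, ← mul_assoc]
    exact ih _ (Fin.tail x) (Fin.tail k)

end Average

/-! ### Invariant means on all real functions on a locally finite group -/

section Mean

open Filter Topology

open scoped BigOperators in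
-- Uniform means over the finite subgroups generated by finite sets `S`, taken to the limit along an
-- ultrafilter. Where the limit fails to exist, `M` is an arbitrary linear extension.
theorem exists_invariant_mean {L : Type*} [Group L]
    (hL : ∀ S : Finset L, Finite (Subgroup.closure (S : Set L))) :
    ∃ M : (L → ℝ) →ₗ[ℝ] ℝ, M (fun _ => 1) = 1 ∧ (∀ k f, M (fun l => f (k * l)) = M f) ∧
      ∀ (f : L → ℝ) (C : ℝ), (∀ l, |f l| ≤ C) → |M f| ≤ C := by
  classical
  let F (S : Finset L) : Finset L := (Set.toFinite (Subgroup.closure (S : Set L) : Set L)).toFinset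
  have memF (S : Finset L) (l : L) : l ∈ F S ↔ l ∈ Subgroup.closure (S : Set L) := by simp [F]
  have Fne (S : Finset L) : (F S).Nonempty := ⟨1, (memF S 1).2 (one_mem _)⟩
  let A (f : L → ℝ) (S : Finset L) : ℝ := 𝔼 l ∈ F S, f l
  have Aadd (f g : L → ℝ) (S) : A (f + g) S = A f S + A g S := by
    simp [A, Finset.expect_add_distrib]
  have Asmul (c : ℝ) (f : L → ℝ) (S) : A (c • f) S = c * A f S := by
    simp [A, Finset.mul_expect]
  have Abd (f : L → ℝ) (C : ℝ) (h : ∀ l, |f l| ≤ C) (S) : |A f S| ≤ C :=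
    (Finset.abs_expect_le _ _).trans (Finset.expect_le (Fne S) fun l _ => h l)
  let U : Ultrafilter (Finset L) := Ultrafilter.of atTop
  have hU : (U : Filter (Finset L)) ≤ atTop := Ultrafilter.of_le atTop
  let V : Submodule ℝ (L → ℝ) :=
    { carrier := {f | ∃ c, Tendsto (A f) U (𝓝 c)}
      add_mem' := by
        rintro f g ⟨c, hc⟩ ⟨d, hd⟩
        exact ⟨c + d, (hc.add hd).congr fun S => (Aadd f g S).symm⟩
      zero_mem' := ⟨0, tendsto_const_nhds.congr fun S => by simp [A]⟩
      smul_mem' := by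
        rintro r f ⟨c, hc⟩
        exact ⟨r * c, (hc.const_mul r).congr fun S => (Asmul r f S).symm⟩ }
  choose lim hlim using fun f : V => f.2
  let ℓ : V →ₗ[ℝ] ℝ :=
    { toFun := lim
      map_add' := fun f g => tendsto_nhds_unique (hlim (f + g))
        (((hlim f).add (hlim g)).congr fun S => (Aadd f g S).symm)
      map_smul' := fun r f => tendsto_nhds_unique (hlim (r • f))
        (((hlim f).const_mul r).congr fun S => (Asmul r f S).symm) }
  obtain ⟨M, hM⟩ := LinearMap.exists_extend ℓ
  have hM' (f : L → ℝ) (c : ℝ) (h : Tendsto (A f) U (𝓝 c)) : M f = c :=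
    (LinearMap.congr_fun hM ⟨f, c, h⟩).trans (tendsto_nhds_unique (hlim ⟨f, c, h⟩) h)
  refine ⟨M, hM' _ _ (tendsto_const_nhds.congr fun S => ?_), fun k f => ?_, fun f C h => ?_⟩
  · simp [A, Finset.expect_const (Fne S)]
  -- Only the difference is tested: its means vanish once `k ∈ S`, so its limit exists even when
  -- that of `f` does not.
  · rw [← sub_eq_zero, ← map_sub]
    refine hM' _ _ (tendsto_const_nhds.congr' ?_)
    filter_upwards [hU (eventually_ge_atTop {k})] with S hS
    have hk : k ∈ Subgroup.closure (S : Set L) :=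
      Subgroup.subset_closure (hS (Finset.mem_singleton_self k))
    have : 𝔼 l ∈ F S, f (k * l) = 𝔼 l ∈ F S, f l := by
      refine Finset.expect_bij (fun l _ => k * l) ?_ ?_ ?_ ?_
      · intro l hl
        exact (memF _ _).2 (mul_mem hk ((memF _ _).1 hl))
      · exact fun _ _ => rfl
      · intro a _ b _ h
        exact mul_left_cancel h
      · intro b hb
        exact ⟨k⁻¹ * b, (memF _ _).2 (mul_mem (inv_mem hk) ((memF _ _).1 hb)), by simp⟩
    simp only [A, Pi.sub_apply, Finset.expect_sub_distrib, this, sub_self]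
  -- For bounded `f` the means stay in a compact interval, so the ultrafilter limit exists and lies
  -- there.
  · obtain ⟨c, hc, hlimc⟩ := (isCompact_Icc (a := -C) (b := C)).ultrafilter_le_nhds (U.map (A f))
      (le_principal_iff.2 (Filter.mem_map.2 (univ_mem' fun S => abs_le.1 (Abd f C h S))))
    rw [hM' f c hlimc]
    exact abs_le.2 hc

theorem Subgroup.IsLocallyFinite.finite_closure {Γ : Type u} [Group Γ] {Λ : Subgroup Γ}
    (h : Λ.IsLocallyFinite) (S : Finset Λ) : Finite (Subgroup.closure (S : Set Λ)) := by
  classical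
  have hfin := h ((Subgroup.closure (S : Set Λ)).map Λ.subtype) (Subgroup.map_subtype_le _)
    ⟨S.image Λ.subtype, by rw [Finset.coe_image, MonoidHom.map_closure]⟩
  exact Finite.of_equiv _ ((Subgroup.closure (S : Set Λ)).equivMapOfInjective Λ.subtype
    Λ.subtype_injective).symm.toEquiv

end Mean

/-! ### Continuity of the averaging operators -/

section Continuity

open Topology

section Slice

variable {X : Type u} [TopologicalSpace X]

theorem continuous_augCoboundary {Y : Type*} [TopologicalSpace Y] (n : ℕ)
    {f : Y → (Fin n → X) → ℝ} (hf : Continuous fun p : Y × (Fin n → X) => f p.1 p.2) :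
    Continuous fun p : Y × (Fin (n + 1) → X) => augCoboundary X n (f p.1) p.2 := by
  cases n with
  | zero =>
    exact hf.comp (continuous_fst.prodMk (continuous_of_const fun _ _ => Subsingleton.elim _ _))
  | succ n =>
    change Continuous fun p : Y × (Fin (n + 2) → X) =>
      ∑ i : Fin (n + 2), (-1 : ℝ) ^ (i : ℕ) * f p.1 (fun j => p.2 (i.succAbove j))
    refine continuous_finsetSum _ fun i _ => continuous_const.mul
      (hf.comp (continuous_fst.prodMk (continuous_pi fun j => ?_)))
    exact (continuous_apply _).comp continuous_snd

theorem continuous_slice {Y : Type*} [TopologicalSpace Y] {n : ℕ}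
    {f : Y → (Fin (n + 1) → X) → ℝ}
    (hf : Continuous fun p : Y × (Fin (n + 1) → X) => f p.1 p.2) :
    Continuous fun p : (Y × X) × (Fin n → X) => slice p.1.2 (f p.1.1) p.2 :=
  hf.comp ((continuous_fst.comp continuous_fst).prodMk
    ((continuous_snd.comp continuous_fst).finCons continuous_snd))

end Slice

variable {K : Type*} {G : Type u} [Group G] [TopologicalSpace G]
  (β : K → G) (M : (K → ℝ) →ₗ[ℝ] ℝ)

/-- Currying gives a continuous map into `C(C, ℝ)` with the sup norm, because `C` is compact; `M` is
1-Lipschitz there. -/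
theorem continuous_functional [IsTopologicalGroup G] {C : Set G} (hC : IsCompact C)
    (hβ : ∀ k, β k ∈ C) (hM : ∀ (f : K → ℝ) (c : ℝ), (∀ l, |f l| ≤ c) → |M f| ≤ c)
    {Y : Type*} [TopologicalSpace Y] {f : Y × G → ℝ} (hf : Continuous f) :
    Continuous fun p : Y × G => M fun k => f (p.1, p.2 * β k) := by
  have : CompactSpace C := isCompact_iff_compactSpace.1 hC
  let F : C(Y × G, C(C, ℝ)) := ContinuousMap.curry
    ⟨fun q : (Y × G) × C => f (q.1.1, q.1.2 * q.2), by fun_prop⟩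
  have hlip : LipschitzWith 1 fun φ : C(C, ℝ) => M fun k => φ ⟨β k, hβ k⟩ := by
    refine LipschitzWith.of_dist_le_mul fun φ ψ => ?_
    rw [NNReal.coe_one, one_mul, Real.dist_eq, ← map_sub]
    refine hM _ _ fun k => ?_
    exact ContinuousMap.dist_apply_le_dist (f := φ) (g := ψ) ⟨β k, hβ k⟩
  exact hlip.continuous.comp F.continuous

variable (hM : ∀ (Y : Type u) [TopologicalSpace Y] (f : Y × G → ℝ), Continuous f →
  Continuous fun p : Y × G => M fun k => f (p.1, p.2 * β k))

include hM in
-- The parameter space `Y` is there for the induction, where the sliced variable becomes a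
-- parameter.
theorem continuous_average (n : ℕ) {Y : Type u} [TopologicalSpace Y]
    {f : Y → (Fin n → G) → ℝ} (hf : Continuous fun p : Y × (Fin n → G) => f p.1 p.2) :
    Continuous fun p : Y × (Fin n → G) => average β M n (f p.1) p.2 := by
  induction n generalizing Y with
  | zero => exact hf
  | succ n ih =>
    have h := hM (Y × (Fin n → G)) (fun q => average β M n (slice q.2 (f q.1.1)) q.1.2)
      ((ih (f := fun q : Y × G => slice q.2 (f q.1)) (continuous_slice hf)).comp (g := fun p : (Y × G) × (Fin n → G) =>
        average β M n (slice p.1.2 (f p.1.1)) p.2)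
        (f := fun q : (Y × (Fin n → G)) × G => ((q.1.1, q.2), q.1.2)) (by fun_prop))
    exact h.comp (f := fun p : Y × (Fin (n + 1) → G) => ((p.1, Fin.tail p.2), p.2 0))
      ((continuous_fst.prodMk (continuous_pi fun j => (continuous_apply _).comp
        continuous_snd)).prodMk ((continuous_apply _).comp continuous_snd))

include hM in
theorem continuous_averageHomotopy (n : ℕ) {Y : Type u} [TopologicalSpace Y]
    {f : Y → (Fin (n + 1) → G) → ℝ}
    (hf : Continuous fun p : Y × (Fin (n + 1) → G) => f p.1 p.2) :
    Continuous fun p : Y × (Fin n → G) => averageHomotopy β M n (f p.1) p.2 := by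
  induction n generalizing Y with
  | zero => exact continuous_const (y := (0 : ℝ))
  | succ n ih =>
    have hs := continuous_slice hf
    have h := ((continuous_average β M hM (n + 1)
      (f := fun q : Y × G => slice q.2 (f q.1)) hs).sub hs).sub
      (continuous_augCoboundary n (f := fun q : Y × G => averageHomotopy β M n (slice q.2 (f q.1)))
        (ih (f := fun q : Y × G => slice q.2 (f q.1)) hs))
    exact h.comp (f := fun p : Y × (Fin (n + 1) → G) => ((p.1, p.2 0), p.2)) (by fun_prop)

include hM in
theorem average_mem_continuousInvariantCochains {n : ℕ} {f : (Fin (n + 1) → G) → ℝ}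
    (hf : f ∈ continuousInvariantCochains G n) :
    average β M (n + 1) f ∈ continuousInvariantCochains G n :=
  ⟨(continuous_average β M hM (n + 1) (Y := PUnit) (f := fun _ => f)
    (hf.1.comp continuous_snd)).comp (f := fun x => (PUnit.unit, x)) (by fun_prop),
    average_mem_invariantCochains β M hf.2⟩

include hM in
theorem averageHomotopy_mem_continuousInvariantCochains {n : ℕ} {f : (Fin (n + 2) → G) → ℝ}
    (hf : f ∈ continuousInvariantCochains G (n + 1)) :
    averageHomotopy β M (n + 1) f ∈ continuousInvariantCochains G n :=
  ⟨(continuous_averageHomotopy β M hM (n + 1) (Y := PUnit) (f := fun _ => f)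
    (hf.1.comp continuous_snd)).comp (f := fun x => (PUnit.unit, x)) (by fun_prop),
    averageHomotopy_mem_invariantCochains β M hf.2⟩

end Continuity

/-! ### The Schlichting completion -/

section Completion

open Topology

variable {Γ : Type u} [Group Γ] (Λ : Subgroup Γ)

theorem denseRange_toSchlichtingCompletion : DenseRange (toSchlichtingCompletion Λ) := by
  intro σ
  rw [closure_subtype]
  have : (Subtype.val '' Set.range (toSchlichtingCompletion Λ)) =
      ((cosetAction Λ).range : Set (Equiv.Perm (Γ ⧸ Λ))) := by
    ext τ
    constructor
    · rintro ⟨_, ⟨γ, rfl⟩, rfl⟩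
      exact ⟨γ, rfl⟩
    · rintro ⟨γ, rfl⟩
      exact ⟨_, ⟨γ, rfl⟩, rfl⟩
  rw [this]
  exact σ.2

/-- The stabilizer of `γΛ` in `Λ` is `Λ ∩ γΛγ⁻¹`, of finite index by commensurability. -/
theorem finite_orbit_of_isCommensurated (h : Λ.IsCommensurated) (x : Γ ⧸ Λ) :
    (MulAction.orbit Λ x).Finite := by
  obtain ⟨γ, rfl⟩ := QuotientGroup.mk_surjective x
  have h1 := ((Subgroup.Commensurable.commensurator_mem_iff Λ γ).1 (h γ)).1
  have h2 : (MulAction.stabilizer Λ (γ : Γ ⧸ Λ)).index ≠ 0 := by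
    convert h1 using 1
    rw [Subgroup.relIndex]
    congr 1
    ext l
    rw [MulAction.mem_stabilizer_iff, Subgroup.mem_subgroupOf, Subgroup.mem_pointwise_smul_iff_inv_smul_mem]
    change ((l * γ : Γ) : Γ ⧸ Λ) = γ ↔ _
    rw [eq_comm, QuotientGroup.eq, ← map_inv, ConjAct.toConjAct_smul]
    simp [mul_assoc]
  rw [MulAction.index_stabilizer] at h2
  exact Set.finite_of_ncard_ne_zero h2

theorem exists_isCompact_schlichtingCompletion (h : Λ.IsCommensurated) :
    ∃ C : Set (schlichtingCompletion Λ), IsCompact C ∧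
      ∀ l : Λ, toSchlichtingCompletion Λ l ∈ C := by
  let X := Γ ⧸ Λ
  let _ : TopologicalSpace X := ⊥
  have : DiscreteTopology X := ⟨rfl⟩
  let D : Set (Equiv.Perm X) :=
    {σ | ∀ x, σ x ∈ MulAction.orbit Λ x ∧ σ⁻¹ x ∈ MulAction.orbit Λ x}
  -- Recording `σ⁻¹` as well makes bijectivity a closed condition; a pointwise limit of permutations
  -- in `X → X` need not be one.
  let e (σ : Equiv.Perm X) : (X → X) × (X → X) := (σ, ⇑σ⁻¹)
  have hcoe : IsInducing (fun σ : Equiv.Perm X => (σ : X → X)) := ⟨rfl⟩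
  have he : IsInducing e := by
    refine IsInducing.of_comp (f := e) (g := Prod.fst) ?_ continuous_fst hcoe
    exact hcoe.continuous.prodMk (hcoe.continuous.comp continuous_inv)
  have hD : IsCompact D := by
    rw [he.isCompact_iff]
    have hP : IsCompact ((Set.univ.pi fun x : X => MulAction.orbit Λ x) ×ˢ
        (Set.univ.pi fun x : X => MulAction.orbit Λ x)) := by
      have := isCompact_univ_pi fun x : X => (finite_orbit_of_isCommensurated Λ h x).isCompact
      exact this.prod this
    have hcl : IsClosed {p : (X → X) × (X → X) | ∀ x, p.1 (p.2 x) = x ∧ p.2 (p.1 x) = x} := by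
      have key (u v : (X → X) × (X → X) → X → X) (hu : Continuous u) (hv : Continuous v) (x : X) :
          IsClosed {p | u p (v p x) = x} := by
        have : Continuous fun p => u p (v p x) := by
          rw [continuous_discrete_rng]
          intro z
          have : (fun p => u p (v p x)) ⁻¹' {z} =
              ⋃ w, {p | v p x = w} ∩ {p | u p w = z} := by
            ext p
            simp
          rw [this]
          exact isOpen_iUnion fun w =>
            ((isOpen_discrete {w}).preimage ((continuous_apply x).comp hv)).inter
              ((isOpen_discrete {z}).preimage ((continuous_apply w).comp hu))
        exact (isClosed_discrete {x}).preimage this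
      simp only [Set.ofPred_forall, Set.ofPred_and]
      exact isClosed_iInter fun x => (key _ _ continuous_fst continuous_snd x).inter
        (key _ _ continuous_snd continuous_fst x)
    convert hP.inter_right hcl using 1
    ext p
    constructor
    · rintro ⟨σ, hσ, rfl⟩
      exact ⟨⟨fun x _ => (hσ x).1, fun x _ => (hσ x).2⟩, fun x => ⟨by simp [e], by simp [e]⟩⟩
    · rintro ⟨⟨h1, h2⟩, h3⟩
      exact ⟨⟨p.1, p.2, fun x => (h3 x).2, fun x => (h3 x).1⟩,
        fun x => ⟨h1 x trivial, h2 x trivial⟩, rfl⟩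
  refine ⟨Subtype.val ⁻¹' D, ?_, fun l x => ⟨⟨l, rfl⟩, ⟨l⁻¹, ?_⟩⟩⟩
  · exact (Subgroup.isClosed_topologicalClosure _).isClosedEmbedding_subtypeVal.isCompact_preimage hD
  · change _ = (((toSchlichtingCompletion Λ l)⁻¹ : schlichtingCompletion Λ) : Equiv.Perm X) x
    rw [← map_inv]
    rfl

end Completion

/-! ### Extension of cochains to the completion -/

section Extension

open Topology

variable {Γ : Type u} [Group Γ] (Λ : Subgroup Γ)

/-- A representative in `Γ` of the coset `σ Λ`, for `σ` in the Schlichting completion. -/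
noncomputable def cosetRep (σ : schlichtingCompletion Λ) : Γ :=
  (σ.1 ((1 : Γ) : Γ ⧸ Λ)).out

theorem isOpen_setOf_cosetRep_eq (γ : Γ) : IsOpen {σ | cosetRep Λ σ = γ} := by
  have : {σ | cosetRep Λ σ = γ} =
      ⋃ x ∈ {x : Γ ⧸ Λ | x.out = γ}, {σ : schlichtingCompletion Λ | σ.1 ((1 : Γ) : Γ ⧸ Λ) = x} := by
    ext σ
    simp [cosetRep]
  rw [this]
  exact isOpen_biUnion fun x _ => (isOpen_perm_apply_eq _ x).preimage continuous_subtype_val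

theorem exists_cosetRep_toSchlichtingCompletion (γ : Γ) :
    ∃ l : Λ, cosetRep Λ (toSchlichtingCompletion Λ γ) = γ * l := by
  have h : (toSchlichtingCompletion Λ γ).1 ((1 : Γ) : Γ ⧸ Λ) = (γ : Γ ⧸ Λ) :=
    congrArg QuotientGroup.mk (mul_one γ)
  obtain ⟨l, hl⟩ := QuotientGroup.mk_out_eq_mul Λ γ
  exact ⟨l, by rw [cosetRep, h, hl]⟩

/-- The extension to the Schlichting completion of functions on `Γⁿ`. -/
noncomputable def extendCochain (n : ℕ) :
    ((Fin n → Γ) → ℝ) →ₗ[ℝ] ((Fin n → schlichtingCompletion Λ) → ℝ) :=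
  LinearMap.funLeft ℝ ℝ fun x i => cosetRep Λ (x i)

theorem continuous_extendCochain (n : ℕ) (f : (Fin n → Γ) → ℝ) :
    Continuous (extendCochain Λ n f) := by
  let _ : TopologicalSpace Γ := ⊥
  have : DiscreteTopology Γ := ⟨rfl⟩
  have h : Continuous (cosetRep Λ) :=
    continuous_discrete_rng.2 fun γ => isOpen_setOf_cosetRep_eq Λ γ
  exact (continuous_of_discreteTopology (f := f)).comp
    (continuous_pi fun i => h.comp (continuous_apply i))

theorem extendCochain_toSchlichtingCompletion {n : ℕ} {f : (Fin n → Γ) → ℝ}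
    (hf : ∀ (x : Fin n → Γ) (l : Fin n → Λ), f (fun i => x i * l i) = f x) (x : Fin n → Γ) :
    extendCochain Λ n f (fun i => toSchlichtingCompletion Λ (x i)) = f x := by
  choose l hl using fun i => exists_cosetRep_toSchlichtingCompletion Λ (x i)
  rw [← hf x l]
  exact congrArg f (funext hl)

theorem denseRange_toSchlichtingCompletion_pi (n : ℕ) :
    DenseRange fun (x : Fin n → Γ) i => toSchlichtingCompletion Λ (x i) :=
  DenseRange.piMap fun _ => denseRange_toSchlichtingCompletion Λ

theorem eq_of_eq_on_toSchlichtingCompletion {n : ℕ}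
    {f g : (Fin n → schlichtingCompletion Λ) → ℝ} (hf : Continuous f) (hg : Continuous g)
    (h : ∀ x : Fin n → Γ, f (fun i => toSchlichtingCompletion Λ (x i)) =
      g fun i => toSchlichtingCompletion Λ (x i)) : f = g :=
  (denseRange_toSchlichtingCompletion_pi Λ n).equalizer hf hg (funext h)

/-- Density is used twice: in the arguments, for translation by elements of `Γ`, then in the
translating element. -/
theorem extendCochain_mem_continuousInvariantCochains {n : ℕ} {f : (Fin (n + 1) → Γ) → ℝ}
    (hf : ∀ (x : Fin (n + 1) → Γ) (l : Fin (n + 1) → Λ), f (fun i => x i * l i) = f x)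
    (hinv : f ∈ invariantCochains Γ n) :
    extendCochain Λ (n + 1) f ∈ continuousInvariantCochains (schlichtingCompletion Λ) n := by
  have hc := continuous_extendCochain Λ (n + 1) f
  refine ⟨hc, fun g x => ?_⟩
  have h2 (γ : Γ) : (fun x : Fin (n + 1) → schlichtingCompletion Λ => extendCochain Λ (n + 1) f
      fun i => toSchlichtingCompletion Λ γ * x i) = extendCochain Λ (n + 1) f := by
    refine eq_of_eq_on_toSchlichtingCompletion Λ (hc.comp (by fun_prop)) hc fun x => ?_
    simp only [← map_mul]
    rw [extendCochain_toSchlichtingCompletion Λ hf (fun i => γ * x i),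
      extendCochain_toSchlichtingCompletion Λ hf, hinv]
  have h3 : (fun g : schlichtingCompletion Λ => extendCochain Λ (n + 1) f fun i => g * x i) =
      fun _ => extendCochain Λ (n + 1) f x :=
    (denseRange_toSchlichtingCompletion Λ).equalizer (hc.comp (by fun_prop)) continuous_const
      (funext fun γ => congrFun (h2 γ) x)
  exact congrFun h3 g

end Extension

/-! ### The cochain homotopy equivalence -/

section Equivalence

theorem continuousCochainComplex_d (G : Type u) [Group G] [TopologicalSpace G] (n : ℕ) :
    (continuousCochainComplex G).d n (n + 1) = ModuleCat.ofHom
      ((coboundary G n).restrict (coboundary_mem_continuousInvariantCochains G n)) := by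
  simp only [continuousCochainComplex, CochainComplex.of_d]

theorem groupCochainComplex_d (G : Type u) [Group G] (n : ℕ) :
    (groupCochainComplex G).d n (n + 1) = ModuleCat.ofHom
      ((coboundary G n).restrict (coboundary_mem_invariantCochains G n)) := by
  simp only [groupCochainComplex, CochainComplex.of_d]

/-- A cochain map is homotopic to the identity as soon as their difference is the total
coboundary of a family of maps `s n : Cⁿ⁺¹ → Cⁿ`. -/
noncomputable def homotopyIdOfSub {C : CochainComplex (ModuleCat.{u} ℝ) ℕ} (φ : C ⟶ C)
    (s : ∀ n, C.X (n + 1) ⟶ C.X n) (h0 : φ.f 0 - 𝟙 _ = C.d 0 1 ≫ s 0)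
    (hs : ∀ n, φ.f (n + 1) - 𝟙 _ = C.d (n + 1) (n + 2) ≫ s (n + 1) + s n ≫ C.d n (n + 1)) :
    Homotopy φ (𝟙 C) := by
  -- Homotopies are indexed by pairs with `j + 1 = i` only propositionally, hence the transport.
  let s' (i j : ℕ) (hij : (ComplexShape.up ℕ).Rel j i) : C.X i ⟶ C.X j :=
    eqToHom (by rw [← show j + 1 = i from hij]) ≫ s j
  have hs' (j : ℕ) (h : (ComplexShape.up ℕ).Rel j (j + 1)) : s' (j + 1) j h = s j := by
    simp [s']
  refine Homotopy.equivSubZero.symm ((Homotopy.ofEq ?_).trans (Homotopy.nullHomotopy' s'))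
  ext1 n
  cases n with
  | zero =>
    rw [Homotopy.nullHomotopicMap'_f_of_not_rel_right (show (ComplexShape.up ℕ).Rel 0 1 from rfl)
      (fun l hl => Nat.succ_ne_zero l hl), hs' 0 rfl]
    exact h0
  | succ n =>
    rw [Homotopy.nullHomotopicMap'_f (show (ComplexShape.up ℕ).Rel n (n + 1) from rfl)
      (show (ComplexShape.up ℕ).Rel (n + 1) (n + 2) from rfl), hs' _ rfl, hs' _ rfl]
    exact hs n

/-- An endomorphism of the complex of homogeneous cochains given by averaging is homotopic to the
identity. -/
noncomputable def groupAverageHomotopyId {K : Type*} {G : Type u} [Group G]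
    (β : K → G) (M : (K → ℝ) →ₗ[ℝ] ℝ) (hM1 : M (fun _ => 1) = 1)
    (φ : groupCochainComplex G ⟶ groupCochainComplex G)
    (hφ : ∀ (n : ℕ) (f : invariantCochains G n),
      ((φ.f n).hom f : invariantCochains G n).1 = average β M (n + 1) f.1) :
    Homotopy φ (𝟙 _) := by
  refine homotopyIdOfSub _ (fun n => ModuleCat.ofHom
    ((averageHomotopy β M (n + 1)).restrict fun f hf => averageHomotopy_mem_invariantCochains β M hf)) ?_ fun n => ?_
  · rw [groupCochainComplex_d]
    refine ModuleCat.hom_ext (LinearMap.ext fun (f : invariantCochains G 0) =>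
      Subtype.ext ?_)
    change ((φ.f 0).hom f : invariantCochains G 0).1 - f.1 =
      averageHomotopy β M 1 (coboundary G 0 f.1)
    exact (congrArg (· - f.1) (hφ 0 f)).trans ((average_sub_eq β M hM1 0 f.1).trans
      ((congrArg (· + _) (map_zero _)).trans (zero_add _)))
  · rw [groupCochainComplex_d, groupCochainComplex_d]
    refine ModuleCat.hom_ext (LinearMap.ext fun (f : invariantCochains G (n + 1)) =>
      Subtype.ext ?_)
    change ((φ.f (n + 1)).hom f : invariantCochains G (n + 1)).1 - f.1 =
      averageHomotopy β M (n + 2) (coboundary G (n + 1) f.1) +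
        coboundary G n (averageHomotopy β M (n + 1) f.1)
    exact (congrArg (· - f.1) (hφ (n + 1) f)).trans
      ((average_sub_eq β M hM1 (n + 1) f.1).trans (add_comm _ _))

/-- An endomorphism of the complex of continuous homogeneous cochains given by averaging is
homotopic to the identity. -/
noncomputable def continuousAverageHomotopyId {K : Type*} {G : Type u} [Group G] [TopologicalSpace G]
    (β : K → G) (M : (K → ℝ) →ₗ[ℝ] ℝ) (hM1 : M (fun _ => 1) = 1)
    (hM : ∀ (Y : Type u) [TopologicalSpace Y] (f : Y × G → ℝ), Continuous f →
      Continuous fun p : Y × G => M fun k => f (p.1, p.2 * β k))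
    (φ : continuousCochainComplex G ⟶ continuousCochainComplex G)
    (hφ : ∀ (n : ℕ) (f : continuousInvariantCochains G n),
      ((φ.f n).hom f : continuousInvariantCochains G n).1 = average β M (n + 1) f.1) :
    Homotopy φ (𝟙 _) := by
  refine homotopyIdOfSub _ (fun n => ModuleCat.ofHom
    ((averageHomotopy β M (n + 1)).restrict fun f hf =>
      averageHomotopy_mem_continuousInvariantCochains β M hM hf)) ?_ fun n => ?_
  · rw [continuousCochainComplex_d]
    refine ModuleCat.hom_ext (LinearMap.ext fun (f : continuousInvariantCochains G 0) =>
      Subtype.ext ?_)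
    change ((φ.f 0).hom f : continuousInvariantCochains G 0).1 - f.1 =
      averageHomotopy β M 1 (coboundary G 0 f.1)
    exact (congrArg (· - f.1) (hφ 0 f)).trans ((average_sub_eq β M hM1 0 f.1).trans
      ((congrArg (· + _) (map_zero _)).trans (zero_add _)))
  · rw [continuousCochainComplex_d, continuousCochainComplex_d]
    refine ModuleCat.hom_ext (LinearMap.ext fun (f : continuousInvariantCochains G (n + 1)) =>
      Subtype.ext ?_)
    change ((φ.f (n + 1)).hom f : continuousInvariantCochains G (n + 1)).1 - f.1 =
      averageHomotopy β M (n + 2) (coboundary G (n + 1) f.1) +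
        coboundary G n (averageHomotopy β M (n + 1) f.1)
    exact (congrArg (· - f.1) (hφ (n + 1) f)).trans
      ((average_sub_eq β M hM1 (n + 1) f.1).trans (add_comm _ _))

end Equivalence

theorem theorem3 {Γ : Type u} [Group Γ] (Λ : Subgroup Γ) (hcomm : Λ.IsCommensurated)
    (hfin : Λ.IsLocallyFinite) (n : ℕ) :
    IsIso (cohomologyRestriction (toSchlichtingCompletion Λ) n) := by
  obtain ⟨M, hM1, hMinv, hMbd⟩ := exists_invariant_mean hfin.finite_closure
  obtain ⟨C, hC, hαC⟩ := exists_isCompact_schlichtingCompletion Λ hcomm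
  let G := schlichtingCompletion Λ
  let α : Γ →* G := toSchlichtingCompletion Λ
  let β : Λ →* Γ := Λ.subtype
  let β' : Λ → G := fun l => α l
  have hMc : ∀ (Y : Type u) [TopologicalSpace Y] (f : Y × G → ℝ), Continuous f →
      Continuous fun p : Y × G => M fun k => f (p.1, p.2 * β' k) :=
    fun Y _ f hf => continuous_functional β' M hC hαC hMbd hf
  have hinv (n : ℕ) (f : (Fin (n + 1) → Γ) → ℝ) (x : Fin (n + 1) → Γ) (l : Fin (n + 1) → Λ) :
      average β M (n + 1) f (fun i => x i * l i) = average β M (n + 1) f x :=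
    average_mul_right β M hMinv (n + 1) f x l
  let ext (n : ℕ) : invariantCochains Γ n →ₗ[ℝ] continuousInvariantCochains G n :=
    ((extendCochain Λ (n + 1)) ∘ₗ average β M (n + 1)).restrict fun f hf =>
      extendCochain_mem_continuousInvariantCochains Λ (hinv n f)
        (average_mem_invariantCochains β M hf)
  have hres (n : ℕ) (f : invariantCochains Γ n) (x : Fin (n + 1) → Γ) :
      (ext n f).1 (fun i => α (x i)) = average β M (n + 1) f.1 x :=
    extendCochain_toSchlichtingCompletion Λ (hinv n f.1) x
  -- `S ∘ R` is averaging on `G`: on the dense image of `Γ` this is `average_comp`.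
  have hext (n : ℕ) (f : continuousInvariantCochains G n) :
      (ext n (cochainRestriction α n f)).1 = average β' M (n + 1) f.1 := by
    refine eq_of_eq_on_toSchlichtingCompletion Λ (ext n _).2.1
      (average_mem_continuousInvariantCochains β' M hMc f.2).1 fun x => ?_
    exact (hres n _ x).trans (average_comp (⇑β) M α (n + 1) f.1 x)
  let S : groupCochainComplex Γ ⟶ continuousCochainComplex G :=
    { f := fun n => ModuleCat.ofHom (ext n)
      comm' := by
        rintro n _ rfl
        rw [continuousCochainComplex_d, groupCochainComplex_d]
        refine ModuleCat.hom_ext (LinearMap.ext fun (f : invariantCochains Γ n) =>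
          Subtype.ext ?_)
        change coboundary G n (ext n f).1 = (ext (n + 1)
          ⟨coboundary Γ n f.1, coboundary_mem_invariantCochains Γ n _ f.2⟩).1
        refine eq_of_eq_on_toSchlichtingCompletion Λ
          (coboundary_mem_continuousInvariantCochains G n _ (ext n f).2).1 (ext (n + 1) _).2.1
          fun x => ?_
        refine Eq.trans ?_ (hres (n + 1) _ x).symm
        refine Eq.trans ?_ (congrFun (average_augCoboundary β M hM1 (n + 1) f.1) x).symm
        exact congrArg (fun g => coboundary Γ n g x) (funext (hres n f)) }
  let R := cochainComplexRestriction α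
  have hSR : Homotopy (R ≫ S) (𝟙 _) :=
    continuousAverageHomotopyId β' M hM1 hMc _ hext
  have hRS : Homotopy (S ≫ R) (𝟙 _) :=
    groupAverageHomotopyId β M hM1 _ fun n f => funext (hres n f)
  exact (HomotopyEquiv.mk R S hSR hRS).toHomologyIso n |>.isIso_hom
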